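/- All graphs are finite and simple. For a graph $G$ with degree sequence $d$, the Havel–Hakimi algorithm repeatedly removes a largest term $t$ from the current sequence and subtracts $1$ from the $t$ largest remaining terms, stopping when every remaining term is $0$; the residue $R(G)$ is the number of zeroes that remain. A vertex $v$ of $G$ has the Havel–Hakimi property if $v$ has maximum degree in $G$ and no vertex adjacent to $v$ has smaller degree than any vertex other than $v$ that is not adjacent to $v$. Let $\mathcal S$ be the class of graphs $G$ such that, in every induced subgraph $H$ of $G$, every vertex of maximum degree in $H$ has the Havel–Hakimi property in $H$. Let $\alpha(G)$ denote the independence number of $G$. The Maxine heuristic starts with $G$ and, as long as the current graph contains an edge, chooses and deletes a vertex of maximum degree in the current graph; its output is the set of vertices that remain at the end. **Theorem.** If $G\in\mathcal S$, then $R(G)=\alpha(G)$. Moreover, for $G \in \mathcal S$ the Maxine heuristic always produces a maximum independent set of $G$: at least one application of it terminates with an output, and, whichever vertices of maximum degree are chosen, the resulting output is an independent set of size $\alpha(G)$. -/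

import Mathlib

/-- One round of the Havel–Hakimi algorithm: order the terms from largest to smallest, remove the
first term `t`, and subtract `1` from the next `t` terms. (For degree sequences of graphs the `t`
terms exist and are positive, so the truncated subtraction plays no role.) -/
def havelHakimiStep (d : Multiset ℕ) : Multiset ℕ :=
  match d.sort (· ≥ ·) with
  | [] => 0
  | t :: rest => ((rest.take t).map (· - 1) ++ rest.drop t : List ℕ)

theorem card_havelHakimiStep_lt (d : Multiset ℕ) (hd : ¬ ∀ t ∈ d, t = 0) :
    (havelHakimiStep d).card < d.card := by
  have hlen : (d.sort (· ≥ ·)).length = d.card := Multiset.length_sort _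
  unfold havelHakimiStep
  split
  · next h =>
    rw [h] at hlen
    exact absurd (fun t ht => by
      rw [Multiset.card_eq_zero.mp hlen.symm] at ht
      exact absurd ht (Multiset.notMem_zero t)) hd
  · next t rest h =>
    rw [h] at hlen
    simp only [List.length_cons] at hlen
    simp only [Multiset.coe_card, List.length_append, List.length_map, List.length_take,
      List.length_drop]
    omega

/-- The residue of a degree sequence `d`: run the Havel–Hakimi algorithm until all remaining terms
are zero, and count these zeroes. -/
def residue (d : Multiset ℕ) : ℕ :=
  if ∀ t ∈ d, t = 0 then d.card else residue (havelHakimiStep d)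
termination_by d.card
decreasing_by exact card_havelHakimiStep_lt d (by assumption)

namespace SimpleGraph

open Classical in
/-- The degree sequence of a finite graph, as a multiset of natural numbers. -/
noncomputable def degreeSequence {V : Type*} [Fintype V] (G : SimpleGraph V) : Multiset ℕ :=
  (Finset.univ : Finset V).val.map (fun v => G.degree v)

/-- The Havel–Hakimi residue `R(G)` of a finite graph. -/
noncomputable def havelHakimiResidue {V : Type*} [Fintype V] (G : SimpleGraph V) : ℕ :=
  residue G.degreeSequence

open Classical in
/-- `v` is a vertex of maximum degree in `G`. -/
def IsMaxDegreeVertex {V : Type*} [Fintype V] (G : SimpleGraph V) (v : V) : Prop :=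
  ∀ u : V, G.degree u ≤ G.degree v

open Classical in
/-- `v` has the Havel–Hakimi property in `G`: it has maximum degree, and no neighbor `w` of `v` has
degree smaller than that of any vertex `u ≠ v` not adjacent to `v`. -/
def HasHavelHakimiProperty {V : Type*} [Fintype V] (G : SimpleGraph V) (v : V) : Prop :=
  G.IsMaxDegreeVertex v ∧
    ∀ w u : V, G.Adj v w → u ≠ v → ¬ G.Adj v u → ¬ G.degree w < G.degree u

/-- `G` has the strong Havel–Hakimi property (that is, `G` belongs to the class `𝒮`): in every
induced subgraph of `G`, every vertex of maximum degree has the Havel–Hakimi property. -/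
def StrongHavelHakimi {V : Type*} (G : SimpleGraph V) : Prop :=
  ∀ (W : Finset V) (v : (W : Set V)),
    (G.induce (W : Set V)).IsMaxDegreeVertex v → (G.induce (W : Set V)).HasHavelHakimiProperty v

open Classical in
/-- One step of the Maxine heuristic on the current vertex set `W`: the graph `G[W]` still has an
edge, and some vertex `v` of maximum degree in `G[W]` is deleted, leaving `W'`. -/
def MaxineStep {V : Type*} (G : SimpleGraph V) (W W' : Finset V) : Prop :=
  G.induce (W : Set V) ≠ ⊥ ∧
    ∃ v : (W : Set V), (G.induce (W : Set V)).IsMaxDegreeVertex v ∧ W' = W.erase v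

/-- `I` is the result of some application of the Maxine heuristic to `G`: it is reached from the
full vertex set by finitely many deletion steps, and `G[I]` has no edges. -/
def IsMaxineOutput {V : Type*} [Fintype V] (G : SimpleGraph V) (I : Finset V) : Prop :=
  Relation.ReflTransGen G.MaxineStep Finset.univ I ∧ G.induce (I : Set V) = ⊥

end SimpleGraph

/-!
Deleting a vertex `v` with the Havel–Hakimi property performs exactly one Havel–Hakimi step on the
degree sequence. Hence in the class `𝒮` the residue is invariant under Maxine steps, and since it
counts the vertices of an edgeless graph, every Maxine output has `R(G)` elements. It remains to see
that no independent set `J` is larger, for which it suffices that some vertex of maximum degree can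
be deleted without losing an independent set of size `#J`.

This is clear unless `J` contains every vertex of maximum degree. In that case let `v` be one of
them; all neighbors of `v` have smaller degree, and we look for a neighbor `w` of `v` whose only
neighbor in `J` is `v`, so that `w` can replace `v` in `J`. Suppose there is none, and fix a
neighbor `w`. Since `w` has smaller degree than `v`, there are more vertices `x ≠ w` adjacent to `v`
but not to `w` than neighbors of `w` in `J` other than `v`. Graphs in `𝒮` have no induced path on
five vertices, so each such `x` shares with `w` a neighbor in `J` other than `v`. By the pigeonhole
principle two of these vertices, `x` and `y`, share the same `u`, and then `{u, v, w, x, y}` induces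
a subgraph that is forbidden in `𝒮`.
-/

namespace HavelHakimi

open Finset

section Sequences

theorem sort_add {α : Type*} (r : α → α → Prop) [DecidableRel r] [IsTrans α r] [Std.Antisymm r]
    [Std.Total r] {A B : Multiset α} (hAB : ∀ a ∈ A, ∀ b ∈ B, r a b) :
    (A + B).sort r = A.sort r ++ B.sort r := by
  refine List.Perm.eq_of_pairwise' (Multiset.pairwise_sort _ r)
    (List.pairwise_append.mpr ⟨Multiset.pairwise_sort _ r, Multiset.pairwise_sort _ r, ?_⟩) ?_
  · simpa only [Multiset.mem_sort] using hAB
  · rw [← Multiset.coe_eq_coe, ← Multiset.coe_add]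
    simp only [Multiset.sort_eq]

theorem havelHakimiStep_cons_add {A B : Multiset ℕ} (hA : ∀ a ∈ A, a ≤ A.card)
    (hB : ∀ b ∈ B, b ≤ A.card) (hAB : ∀ a ∈ A, ∀ b ∈ B, b ≤ a) :
    havelHakimiStep (A.card ::ₘ (A + B)) = A.map (· - 1) + B := by
  have hsort : (A.card ::ₘ (A + B)).sort (· ≥ ·) =
      A.card :: (A.sort (· ≥ ·) ++ B.sort (· ≥ ·)) := by
    rw [Multiset.sort_cons, sort_add _ hAB]
    intro b hb
    exact (Multiset.mem_add.mp hb).elim (hA b) (hB b)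
  have hlen : (A.sort (· ≥ ·)).length = A.card := Multiset.length_sort _
  rw [havelHakimiStep, hsort]
  simp only [List.take_left' hlen, List.drop_left' hlen]
  rw [← Multiset.coe_add, ← Multiset.map_coe, Multiset.sort_eq, Multiset.sort_eq]

theorem residue_of_forall_eq_zero {d : Multiset ℕ} (hd : ∀ t ∈ d, t = 0) :
    residue d = d.card := by
  rw [residue, if_pos hd]

theorem residue_havelHakimiStep {d : Multiset ℕ} (hd : ¬ ∀ t ∈ d, t = 0) :
    residue (havelHakimiStep d) = residue d := by
  rw [residue.eq_def d, if_neg hd]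

end Sequences

variable {V : Type*} {G : SimpleGraph V} {W I J : Finset V} {u v w x y : V}

section InducedSubgraphs

theorem forall_mem_degreeSequence_eq_zero_iff [Fintype V] :
    (∀ t ∈ G.degreeSequence, t = 0) ↔ G = ⊥ := by
  simp only [SimpleGraph.degreeSequence, Multiset.mem_map, mem_val, mem_univ, true_and,
    forall_exists_index, forall_apply_eq_imp_iff, SimpleGraph.degree_eq_zero,
    SimpleGraph.IsIsolated, SimpleGraph.eq_bot_iff_forall_not_adj]

theorem havelHakimiResidue_bot [Fintype V] :
    (⊥ : SimpleGraph V).havelHakimiResidue = Fintype.card V := by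
  rw [SimpleGraph.havelHakimiResidue,
    residue_of_forall_eq_zero (forall_mem_degreeSequence_eq_zero_iff.mpr rfl),
    SimpleGraph.degreeSequence, Multiset.card_map, card_val, card_univ]

theorem induce_eq_bot_iff_isIndepSet {s : Set V} : G.induce s = ⊥ ↔ G.IsIndepSet s := by
  simp only [SimpleGraph.eq_bot_iff_forall_not_adj, SimpleGraph.induce_adj, Subtype.forall]
  exact ⟨fun h a ha b hb _ => h a ha b hb, fun h a ha b hb hab => h ha hb hab.ne hab⟩

open Classical in
/-- The neighbors of `v` in the finite set `W`. Their number is the degree of `v` in `G[W]` when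
`v ∈ W`; working with it avoids the subtype of vertices of `G[W]`. -/
noncomputable def neighborsIn (G : SimpleGraph V) (W : Finset V) (v : V) : Finset V :=
  {u ∈ W | G.Adj v u}

@[simp]
theorem mem_neighborsIn : u ∈ neighborsIn G W v ↔ u ∈ W ∧ G.Adj v u := by
  simp only [neighborsIn, mem_filter]

theorem degree_induce (v : (W : Set V)) [Fintype ((G.induce (W : Set V)).neighborSet v)] :
    (G.induce (W : Set V)).degree v = #(neighborsIn G W v) := by
  rw [← SimpleGraph.card_neighborFinset_eq_degree,
    ← card_map (Function.Embedding.subtype (· ∈ (W : Set V)))]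
  congr 1
  ext u
  simp [and_comm]

theorem degreeSequence_induce :
    (G.induce (W : Set V)).degreeSequence = W.val.map fun v => #(neighborsIn G W v) := by
  simp only [SimpleGraph.degreeSequence, degree_induce]
  exact Multiset.attach_map_val' W.val fun v => #(neighborsIn G W v)

theorem havelHakimiResidue_induce_univ [Fintype V] :
    (G.induce ((univ : Finset V) : Set V)).havelHakimiResidue = G.havelHakimiResidue := by
  rw [SimpleGraph.havelHakimiResidue, degreeSequence_induce, SimpleGraph.havelHakimiResidue]
  congr 1
  refine Multiset.map_congr rfl fun v _ => ?_
  rw [← SimpleGraph.card_neighborFinset_eq_degree]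
  congr 1
  ext u
  simp

theorem isMaxDegreeVertex_induce_iff {v : (W : Set V)} :
    (G.induce (W : Set V)).IsMaxDegreeVertex v ↔
      ∀ u ∈ W, #(neighborsIn G W u) ≤ #(neighborsIn G W v) := by
  simp only [SimpleGraph.IsMaxDegreeVertex, degree_induce, Subtype.forall, SetLike.mem_coe]

theorem card_neighborsIn_le_of_hasHavelHakimiProperty {v : (W : Set V)}
    (hv : (G.induce (W : Set V)).HasHavelHakimiProperty v) (hw : w ∈ W) (hvw : G.Adj v w)
    (hu : u ∈ W) (huv : u ≠ v) (hvu : ¬ G.Adj v u) :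
    #(neighborsIn G W u) ≤ #(neighborsIn G W w) := by
  have h := hv.2 ⟨w, hw⟩ ⟨u, hu⟩ hvw (fun h => huv (congrArg Subtype.val h)) hvu
  simpa only [degree_induce, not_lt] using h

theorem card_neighborsIn_le (hG : G.StrongHavelHakimi) (hv : v ∈ W)
    (hmax : ∀ x ∈ W, #(neighborsIn G W x) ≤ #(neighborsIn G W v)) (hw : w ∈ W)
    (hvw : G.Adj v w) (hu : u ∈ W) (huv : u ≠ v) (hvu : ¬ G.Adj v u) :
    #(neighborsIn G W u) ≤ #(neighborsIn G W w) :=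
  card_neighborsIn_le_of_hasHavelHakimiProperty
    (hG W ⟨v, hv⟩ (isMaxDegreeVertex_induce_iff.mpr hmax)) hw hvw hu huv hvu

theorem exists_isMaxDegreeVertex_induce (hW : G.induce (W : Set V) ≠ ⊥) :
    ∃ v : (W : Set V), (G.induce (W : Set V)).IsMaxDegreeVertex v ∧
      (neighborsIn G W v).Nonempty := by
  obtain ⟨a, b, hab⟩ := SimpleGraph.ne_bot_iff_exists_adj.mp hW
  obtain ⟨v, hv, hmax⟩ := W.exists_max_image (fun u => #(neighborsIn G W u)) ⟨a, a.2⟩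
  refine ⟨⟨v, hv⟩, isMaxDegreeVertex_induce_iff.mpr hmax, card_pos.mp ?_⟩
  exact (card_pos.mpr ⟨(b : V), mem_neighborsIn.mpr ⟨b.2, hab⟩⟩).trans_le (hmax a a.2)

end InducedSubgraphs

section VertexDeletion

variable [DecidableEq V]

theorem neighborsIn_erase : neighborsIn G (W.erase v) u = (neighborsIn G W u).erase v := by
  ext x
  simp only [mem_neighborsIn, mem_erase, and_assoc]

theorem card_neighborsIn_erase_of_adj (hv : v ∈ W) (hvu : G.Adj v u) :
    #(neighborsIn G (W.erase v) u) = #(neighborsIn G W u) - 1 := by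
  rw [neighborsIn_erase, card_erase_of_mem (mem_neighborsIn.mpr ⟨hv, hvu.symm⟩)]

theorem card_neighborsIn_erase_of_not_adj (hvu : ¬ G.Adj v u) :
    #(neighborsIn G (W.erase v) u) = #(neighborsIn G W u) := by
  rw [neighborsIn_erase, erase_eq_of_notMem fun h => hvu (mem_neighborsIn.mp h).2.symm]

theorem havelHakimiStep_degreeSequence_induce {v : (W : Set V)}
    (hv : (G.induce (W : Set V)).HasHavelHakimiProperty v) :
    havelHakimiStep (G.induce (W : Set V)).degreeSequence =
      (G.induce (W.erase v : Set V)).degreeSequence := by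
  let deg (u : V) : ℕ := #(neighborsIn G W u)
  let N : Finset V := neighborsIn G W v
  let R : Finset V := W.erase v \ N
  have mem_N {u : V} (hu : u ∈ N) : u ∈ W ∧ G.Adj v u := mem_neighborsIn.mp hu
  have mem_R {u : V} (hu : u ∈ R) : u ∈ W ∧ u ≠ v ∧ ¬ G.Adj v u := by
    simp only [R, N, mem_sdiff, mem_erase, mem_neighborsIn] at hu
    tauto
  have hmax : ∀ u ∈ W, deg u ≤ (N.val.map deg).card := by
    rw [Multiset.card_map]
    exact isMaxDegreeVertex_induce_iff.mp hv.1
  have hNR : (W.erase v).val = N.val + R.val := by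
    have hN : N ⊆ W.erase v := fun u hu => mem_erase.mpr ⟨(mem_N hu).2.ne', (mem_N hu).1⟩
    rw [sdiff_val, add_tsub_cancel_of_le (val_le_iff.mpr hN)]
  calc havelHakimiStep (G.induce (W : Set V)).degreeSequence
    _ = havelHakimiStep ((N.val.map deg).card ::ₘ (N.val.map deg + R.val.map deg)) := by
      rw [degreeSequence_induce, ← Multiset.cons_erase v.2, ← erase_val, hNR, Multiset.map_cons,
        Multiset.map_add, Multiset.card_map, card_val]
    _ = (N.val.map deg).map (· - 1) + R.val.map deg := by
      refine havelHakimiStep_cons_add ?_ ?_ ?_ <;>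
        simp only [Multiset.forall_mem_map_iff, mem_val]
      · exact fun w hw => hmax w (mem_N hw).1
      · exact fun u hu => hmax u (mem_R hu).1
      · exact fun w hw u hu => card_neighborsIn_le_of_hasHavelHakimiProperty hv (mem_N hw).1
          (mem_N hw).2 (mem_R hu).1 (mem_R hu).2.1 (mem_R hu).2.2
    _ = (G.induce (W.erase v : Set V)).degreeSequence := by
      rw [degreeSequence_induce, hNR, Multiset.map_add, Multiset.map_map]
      congr 1 <;> refine Multiset.map_congr rfl fun u hu => ?_
      · exact (card_neighborsIn_erase_of_adj v.2 (mem_N hu).2).symm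
      · exact (card_neighborsIn_erase_of_not_adj (mem_R hu).2.2).symm

theorem havelHakimiResidue_induce_erase {v : (W : Set V)} (hW : G.induce (W : Set V) ≠ ⊥)
    (hv : (G.induce (W : Set V)).HasHavelHakimiProperty v) :
    (G.induce (W.erase v : Set V)).havelHakimiResidue =
      (G.induce (W : Set V)).havelHakimiResidue := by
  rw [SimpleGraph.havelHakimiResidue, ← havelHakimiStep_degreeSequence_induce hv]
  exact residue_havelHakimiStep (forall_mem_degreeSequence_eq_zero_iff.not.mpr hW)

end VertexDeletion

section ForbiddenSubgraphs

theorem card_neighborsIn_add_two_le (hu : u ∈ W) (hv : v ∈ W) (huv : u ≠ v)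
    (nuv : ¬ G.Adj u v) : #(neighborsIn G W u) + 2 ≤ #W := by
  classical
  have hsub : neighborsIn G W u ⊆ W \ {u, v} := by
    intro x hx
    obtain ⟨hxW, hux⟩ := mem_neighborsIn.mp hx
    simp only [mem_sdiff, mem_insert, mem_singleton, not_or]
    exact ⟨hxW, hux.ne', fun h => nuv (h ▸ hux)⟩
  have hpair : ({u, v} : Finset V) ⊆ W := insert_subset hu (singleton_subset_iff.mpr hv)
  calc #(neighborsIn G W u) + 2
    _ ≤ #(W \ {u, v}) + #{u, v} := add_le_add (card_le_card hsub) (card_pair huv).ge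
    _ = #W := card_sdiff_add_card_eq_card hpair

theorem not_inducedPath_five (hG : G.StrongHavelHakimi) {a b c d e : V} (hab : G.Adj a b)
    (hbc : G.Adj b c) (hcd : G.Adj c d) (hde : G.Adj d e) (hac : ¬ G.Adj a c)
    (had : ¬ G.Adj a d) (hae : ¬ G.Adj a e) (hbd : ¬ G.Adj b d) (hbe : ¬ G.Adj b e)
    (hce : ¬ G.Adj c e) : False := by
  classical
  let W : Finset V := {a, b, c, d, e}
  have hNa : neighborsIn G W a = {b} := by grind [mem_neighborsIn, G.adj_comm, G.irrefl]
  have hNb : neighborsIn G W b = {a, c} := by grind [mem_neighborsIn, G.adj_comm, G.irrefl]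
  have hNc : neighborsIn G W c = {b, d} := by grind [mem_neighborsIn, G.adj_comm, G.irrefl]
  have hNd : neighborsIn G W d = {c, e} := by grind [mem_neighborsIn, G.adj_comm, G.irrefl]
  have hNe : neighborsIn G W e = {d} := by
    grind (splits := 15) [mem_neighborsIn, G.adj_comm, G.irrefl]
  have ne_ac : a ≠ c := fun h => had (h ▸ hcd)
  have ne_ce : c ≠ e := fun h => hbe (h ▸ hbc)
  have ne_db : d ≠ b := fun h => had (h ▸ hab)
  have hmax : ∀ x ∈ W, #(neighborsIn G W x) ≤ #(neighborsIn G W b) := by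
    simp only [W, mem_insert, mem_singleton, forall_eq_or_imp, forall_eq, hNa, hNb, hNc, hNd, hNe,
      card_singleton, card_pair ne_ac, card_le_two, le_refl, Nat.one_le_ofNat, and_self]
  have hda : #(neighborsIn G W d) ≤ #(neighborsIn G W a) :=
    card_neighborsIn_le hG (by simp [W]) hmax (by simp [W]) hab.symm (by simp [W]) ne_db hbd
  rw [hNd, hNa, card_pair ne_ce, card_singleton] at hda
  omega

theorem eq_of_not_adj_of_mem_commonNeighbors (hG : G.StrongHavelHakimi) (huv : u ≠ v)
    (nuv : ¬ G.Adj u v) (hw : w ∈ G.commonNeighbors u v) (hx : x ∈ G.commonNeighbors u v)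
    (hy : y ∈ G.commonNeighbors u v) (hwx : w ≠ x) (nwx : ¬ G.Adj w x) (hwy : w ≠ y)
    (nwy : ¬ G.Adj w y) : x = y := by
  classical
  by_contra hxy
  let W : Finset V := {u, v, w, x, y}
  rw [SimpleGraph.mem_commonNeighbors] at hw hx hy
  have hnonadj : ∀ z ∈ W, ∃ z' ∈ W, z ≠ z' ∧ ¬ G.Adj z z' := by grind [G.adj_comm]
  have three_le_of_subset {z : V} (hz : {w, x, y} ⊆ neighborsIn G W z) :
      3 ≤ #(neighborsIn G W z) :=
    (card_eq_three.mpr ⟨w, x, y, hwx, hwy, hxy, rfl⟩).ge.trans (card_le_card hz)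
  have hNu : 3 ≤ #(neighborsIn G W u) := three_le_of_subset (by grind [mem_neighborsIn])
  have hNv : 3 ≤ #(neighborsIn G W v) := three_le_of_subset (by grind [mem_neighborsIn])
  have hNw : #(neighborsIn G W w) ≤ 2 := by
    have hsub : neighborsIn G W w ⊆ {u, v} := by grind [mem_neighborsIn, G.irrefl]
    exact (card_le_card hsub).trans card_le_two
  have hmax : ∀ z ∈ W, #(neighborsIn G W z) ≤ #(neighborsIn G W v) := by
    intro z hz
    obtain ⟨z', hz', hne, hnadj⟩ := hnonadj z hz
    have hcard := card_neighborsIn_add_two_le hz hz' hne hnadj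
    have hW : #W ≤ 5 := card_le_five
    omega
  have huw : #(neighborsIn G W u) ≤ #(neighborsIn G W w) :=
    card_neighborsIn_le hG (by simp [W]) hmax (by simp [W]) hw.2 (by simp [W]) huv
      fun h => nuv h.symm
  omega

end ForbiddenSubgraphs

section IndependentSets

theorem exists_common_neighbor_of_not_adj (hG : G.StrongHavelHakimi) {J : Set V}
    (hJ : G.IsIndepSet J) (hv : v ∈ J) (hvw : G.Adj v w) (hvx : G.Adj v x) (nwx : ¬ G.Adj w x)
    (hw : ∃ u ∈ J, u ≠ v ∧ G.Adj w u) (hx : ∃ u ∈ J, u ≠ v ∧ G.Adj x u) :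
    ∃ u ∈ J, u ≠ v ∧ G.Adj w u ∧ G.Adj x u := by
  obtain ⟨a, ha, hav, hwa⟩ := hw
  obtain ⟨b, hb, hbv, hxb⟩ := hx
  by_cases hxa : G.Adj x a
  · exact ⟨a, ha, hav, hwa, hxa⟩
  by_cases hwb : G.Adj w b
  · exact ⟨b, hb, hbv, hwb, hxb⟩
  have hab : ¬ G.Adj a b := fun h => hJ ha hb h.ne h
  exact (not_inducedPath_five hG hwa.symm hvw.symm hvx hxb (hJ ha hv hav) (fun h => hxa h.symm)
    hab nwx hwb (hJ hv hb hbv.symm)).elim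

theorem card_neighborsIn_erase_lt_card_sdiff [DecidableEq V] (hJW : J ⊆ W)
    (hJ : G.IsIndepSet (J : Set V)) (hv : v ∈ J) (hw : w ∈ neighborsIn G W v)
    (hlt : #(neighborsIn G W w) < #(neighborsIn G W v)) :
    #(neighborsIn G (J.erase v) w) < #((neighborsIn G W v \ neighborsIn G W w).erase w) := by
  have hvw : G.Adj v w := (mem_neighborsIn.mp hw).2
  have hsub : neighborsIn G J w ⊆ neighborsIn G W w \ neighborsIn G W v := by
    intro u hu
    obtain ⟨huJ, hwu⟩ := mem_neighborsIn.mp hu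
    refine mem_sdiff.mpr ⟨mem_neighborsIn.mpr ⟨hJW huJ, hwu⟩, fun huv => ?_⟩
    have hvu : G.Adj v u := (mem_neighborsIn.mp huv).2
    exact hJ hv huJ hvu.ne hvu
  have hwsdiff : w ∈ neighborsIn G W v \ neighborsIn G W w :=
    mem_sdiff.mpr ⟨hw, fun h => G.irrefl (mem_neighborsIn.mp h).2⟩
  have hne : 0 < #(neighborsIn G J w) := card_pos.mpr ⟨v, mem_neighborsIn.mpr ⟨hv, hvw.symm⟩⟩
  rw [card_neighborsIn_erase_of_adj hv hvw, card_erase_of_mem hwsdiff]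
  exact Nat.sub_lt_sub_right hne
    ((card_le_card hsub).trans_lt (card_sdiff_lt_card_sdiff_iff.mpr hlt))

theorem exists_neighbor_unique_in_indepSet (hG : G.StrongHavelHakimi) (hJW : J ⊆ W)
    (hJ : G.IsIndepSet (J : Set V)) (hv : v ∈ J) (hN : (neighborsIn G W v).Nonempty)
    (hlt : ∀ w ∈ neighborsIn G W v, #(neighborsIn G W w) < #(neighborsIn G W v)) :
    ∃ w ∈ neighborsIn G W v, ∀ u ∈ J, G.Adj w u → u = v := by
  classical
  by_contra! hcon
  obtain ⟨w, hw⟩ := hN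
  let X : Finset V := (neighborsIn G W v \ neighborsIn G W w).erase w
  let U : Finset V := neighborsIn G (J.erase v) w
  have mem_X {x : V} (hx : x ∈ X) : x ∈ neighborsIn G W v ∧ w ≠ x ∧ ¬ G.Adj w x := by
    grind [mem_neighborsIn]
  have mem_U {u : V} : u ∈ U ↔ u ∈ J ∧ u ≠ v ∧ G.Adj w u := by grind [mem_neighborsIn]
  have hUX : #U < #X := card_neighborsIn_erase_lt_card_sdiff hJW hJ hv hw (hlt w hw)
  have hcommon : ∀ x ∈ X, ∃ u ∈ U, G.Adj x u := by
    intro x hx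
    obtain ⟨hxN, -, nwx⟩ := mem_X hx
    obtain ⟨u, huJ, huv, hwu, hxu⟩ := exists_common_neighbor_of_not_adj hG hJ hv
      (mem_neighborsIn.mp hw).2 (mem_neighborsIn.mp hxN).2 nwx (by grind) (by grind)
    exact ⟨u, mem_U.mpr ⟨huJ, huv, hwu⟩, hxu⟩
  choose! f hfU hf using hcommon
  obtain ⟨x, hx, y, hy, hxy, hfxy⟩ := exists_ne_map_eq_of_card_lt_of_maps_to hUX hfU
  obtain ⟨hfJ, hfv, hwf⟩ := mem_U.mp (hfU x hx)
  obtain ⟨hxN, hwx, nwx⟩ := mem_X hx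
  obtain ⟨hyN, hwy, nwy⟩ := mem_X hy
  have mem_common {z : V} (hz : z ∈ neighborsIn G W v) (hzf : G.Adj z (f x)) :
      z ∈ G.commonNeighbors (f x) v := ⟨hzf.symm, (mem_neighborsIn.mp hz).2⟩
  exact hxy (eq_of_not_adj_of_mem_commonNeighbors hG hfv (hJ hfJ hv hfv) (mem_common hw hwf)
    (mem_common hxN (hf x hx)) (mem_common hyN (hfxy ▸ hf y hy)) hwx nwx hwy nwy)

theorem isIndepSet_insert_erase [DecidableEq V] (hJ : G.IsIndepSet (J : Set V))
    (hw : ∀ u ∈ J, G.Adj w u → u = v) :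
    G.IsIndepSet (insert w (J.erase v) : Finset V) := by
  rw [coe_insert, SimpleGraph.isIndepSet_iff]
  refine (Set.Pairwise.mono (coe_subset.mpr (erase_subset v J)) hJ).insert fun u hu _ => ?_
  obtain ⟨huv, huJ⟩ := mem_erase.mp hu
  exact ⟨fun hwu => huv (hw u huJ hwu), fun huw => huv (hw u huJ huw.symm)⟩

theorem exists_isMaxDegreeVertex_isIndepSet_erase [DecidableEq V] (hG : G.StrongHavelHakimi)
    (hW : G.induce (W : Set V) ≠ ⊥) (hJW : J ⊆ W) (hJ : G.IsIndepSet (J : Set V)) :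
    ∃ v : (W : Set V), (G.induce (W : Set V)).IsMaxDegreeVertex v ∧
      ∃ I ⊆ W.erase v, G.IsIndepSet (I : Set V) ∧ #I = #J := by
  by_cases hex : ∃ v : (W : Set V), (G.induce (W : Set V)).IsMaxDegreeVertex v ∧ (v : V) ∉ J
  · obtain ⟨v, hmax, hvJ⟩ := hex
    exact ⟨v, hmax, J, subset_erase.mpr ⟨hJW, hvJ⟩, hJ, rfl⟩
  push Not at hex
  obtain ⟨v, hmax, hN⟩ := exists_isMaxDegreeVertex_induce hW
  have hvJ : (v : V) ∈ J := hex v hmax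
  have hdeg := isMaxDegreeVertex_induce_iff.mp hmax
  have notMem_J {w : V} (hw : w ∈ neighborsIn G W v) : w ∉ J := fun hwJ =>
    have hvw : G.Adj v w := (mem_neighborsIn.mp hw).2
    hJ hvJ hwJ hvw.ne hvw
  have hlt : ∀ w ∈ neighborsIn G W v, #(neighborsIn G W w) < #(neighborsIn G W v) := by
    intro w hw
    have hwW : w ∈ W := (mem_neighborsIn.mp hw).1
    refine (hdeg w hwW).lt_of_ne fun heq => notMem_J hw (hex ⟨w, hwW⟩ ?_)
    exact isMaxDegreeVertex_induce_iff.mpr fun u hu => (hdeg u hu).trans_eq heq.symm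
  obtain ⟨w, hw, huniq⟩ := exists_neighbor_unique_in_indepSet hG hJW hJ hvJ hN hlt
  obtain ⟨hwW, hvw⟩ := mem_neighborsIn.mp hw
  refine ⟨v, hmax, insert w (J.erase v), ?_, isIndepSet_insert_erase hJ huniq, ?_⟩
  · exact insert_subset (mem_erase.mpr ⟨hvw.ne', hwW⟩) (erase_subset_erase _ hJW)
  · rw [card_insert_of_notMem fun h => notMem_J hw (mem_of_mem_erase h),
      card_erase_add_one hvJ]

theorem havelHakimiResidue_induce_of_eq_bot (hW : G.induce (W : Set V) = ⊥) :
    (G.induce (W : Set V)).havelHakimiResidue = #W := by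
  rw [hW, havelHakimiResidue_bot]
  exact Fintype.card_coe W

theorem card_le_havelHakimiResidue_induce (hG : G.StrongHavelHakimi) (hJW : J ⊆ W)
    (hJ : G.IsIndepSet (J : Set V)) : #J ≤ (G.induce (W : Set V)).havelHakimiResidue := by
  classical
  induction W using Finset.strongInduction generalizing J with
  | H W ih =>
    by_cases hW : G.induce (W : Set V) = ⊥
    · rw [havelHakimiResidue_induce_of_eq_bot hW]
      exact card_le_card hJW
    obtain ⟨v, hmax, I, hIW, hI, hcard⟩ :=
      exists_isMaxDegreeVertex_isIndepSet_erase hG hW hJW hJ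
    rw [← hcard, ← havelHakimiResidue_induce_erase hW (hG W v hmax)]
    exact ih _ (erase_ssubset v.2) hIW hI

end IndependentSets

section Maxine

theorem havelHakimiResidue_eq_of_maxineStep {W' : Finset V} (hG : G.StrongHavelHakimi)
    (h : G.MaxineStep W W') :
    (G.induce (W' : Set V)).havelHakimiResidue = (G.induce (W : Set V)).havelHakimiResidue := by
  classical
  obtain ⟨hW, v, hmax, rfl⟩ := h
  convert havelHakimiResidue_induce_erase hW (hG W v hmax)

theorem havelHakimiResidue_eq_of_reflTransGen {W' : Finset V} (hG : G.StrongHavelHakimi)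
    (h : Relation.ReflTransGen G.MaxineStep W W') :
    (G.induce (W' : Set V)).havelHakimiResidue = (G.induce (W : Set V)).havelHakimiResidue := by
  induction h with
  | refl => rfl
  | tail _ hstep ih => rw [havelHakimiResidue_eq_of_maxineStep hG hstep, ih]

theorem exists_reflTransGen_maxineStep (G : SimpleGraph V) (W : Finset V) :
    ∃ I : Finset V, Relation.ReflTransGen G.MaxineStep W I ∧ G.induce (I : Set V) = ⊥ := by
  classical
  induction W using Finset.strongInduction with
  | H W ih =>
    by_cases hW : G.induce (W : Set V) = ⊥
    · exact ⟨W, .refl, hW⟩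
    obtain ⟨v, hmax, -⟩ := exists_isMaxDegreeVertex_induce hW
    obtain ⟨I, hWI, hI⟩ := ih (W.erase v) (erase_ssubset v.2)
    exact ⟨I, .head ⟨hW, v, hmax, by convert rfl⟩ hWI, hI⟩

variable [Fintype V]

theorem card_of_isMaxineOutput (hG : G.StrongHavelHakimi) (hI : G.IsMaxineOutput I) :
    #I = G.havelHakimiResidue := by
  rw [← havelHakimiResidue_induce_of_eq_bot hI.2,
    havelHakimiResidue_eq_of_reflTransGen hG hI.1, havelHakimiResidue_induce_univ]

theorem isMaximumIndepSet_of_isMaxineOutput (hG : G.StrongHavelHakimi)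
    (hI : G.IsMaxineOutput I) : G.IsMaximumIndepSet I := by
  refine ⟨induce_eq_bot_iff_isIndepSet.mp hI.2, fun J hJ => ?_⟩
  rw [card_of_isMaxineOutput hG hI, ← havelHakimiResidue_induce_univ]
  exact card_le_havelHakimiResidue_induce hG (subset_univ J) hJ

end Maxine

end HavelHakimi

theorem mainTheorem2 {V : Type*} [Fintype V] (G : SimpleGraph V) (hG : G.StrongHavelHakimi) :
    G.havelHakimiResidue = G.indepNum ∧
      (∃ I : Finset V, G.IsMaxineOutput I) ∧
      ∀ I : Finset V, G.IsMaxineOutput I → G.IsMaximumIndepSet I := by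
  have hmaximum {I : Finset V} (hI : G.IsMaxineOutput I) : G.IsMaximumIndepSet I :=
    HavelHakimi.isMaximumIndepSet_of_isMaxineOutput hG hI
  obtain ⟨I, hI⟩ : ∃ I : Finset V, G.IsMaxineOutput I :=
    HavelHakimi.exists_reflTransGen_maxineStep G Finset.univ
  refine ⟨?_, ⟨I, hI⟩, fun J hJ => hmaximum hJ⟩
  rw [← HavelHakimi.card_of_isMaxineOutput hG hI]
  exact G.maximumIndepSet_card_eq_indepNum I (hmaximum hI)
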